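/- \textbf{Setting.} Let $(\mathcal C,\mathcal M)$ be an adhesive HLR category (pushouts along $\mathcal M$-morphisms are van Kampen squares) with all pullbacks, initial pushouts over $\mathcal M$-morphisms, an initial object $\bot$ all of whose outgoing morphisms are in $\mathcal M$, and a class $\mathcal E'$ of cospans such that every cospan factors, uniquely up to isomorphism, as a cospan in $\mathcal E'$ followed by a morphism in $\mathcal M$. A \emph{condition} over $P$ is built from conjunctions and disjunctions (the empty ones being true and false) and the quantified conditions $Q(p\colon P\to P',d)$ with $Q\in\{\exists,\forall\}$ and $d$ a condition over $P'$. A morphism $q\colon P\to G$ satisfies $\exists(p,d)$ (resp. $\forall(p,d)$) if some (resp. every) $q'\colon P'\to G$ in $\mathcal M$ with $q'\circ p=q$ satisfies $d$. The tree of a condition has its quantified objects (as occurrences) as nodes other than the root and their morphisms as edges. A \emph{rule} $\rho_j=(L_j\xleftarrow{l_j}K_j\xrightarrow{r_j}R_j,ac_j)$ has $l_j,r_j\in\mathcal M$ and a condition $ac_j$ over $L_j$ in which all morphisms, except possibly those starting at the root $L_j$, are in $\mathcal M$. A \emph{transformation} $t_j$ of $G$ via $\rho_j$ is a double-pushout transformation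 $G\xleftarrow{g_j}D_j\xrightarrow{h_j}H_j$ with match $m_j\colon L_j\to G$ satisfying $ac_j$; without the last requirement it is called \emph{ac-disregarding}. Transformations $t_1,t_2$ of $G$ are \emph{parallel independent} if there are $d_1\colon L_2\to D_1$, $d_2\colon L_1\to D_2$ with $m_2=g_1d_1$, $m_1=g_2d_2$, $h_1d_1\models ac_2$ and $h_2d_2\models ac_1$; otherwise they are \emph{parallel dependent}. They are \emph{parallel independent ac-disregarding} if such $d_1,d_2$ with $m_2=g_1d_1$ and $m_1=g_2d_2$ exist. \textbf{Overlaps.} A \emph{rule overlap} of $\rho_1,\rho_2$ consists of a span $P\xleftarrow{b_1}A\xrightarrow{b_2}P'$ and morphisms $p_{1}\colon L_1\to P$, $p_{2}\colon L_2\to P'$. It is \emph{embeddable} in $(t_1,t_2)$ if there are $x_1\colon P\to G$, $x_2\colon P'\to G$ with $m_1=x_1p_{1}$, $m_2=x_2p_{2}$ such that $(b_1,b_2)$ is a pullback of $(x_1,x_2)$. It is \emph{ac-conflicting} if it is embeddable in some pair of ac-disregarding transformations that is parallel independent ac-disregarding. A \emph{composition} of overlaps $o,o'$, whose data are those above and the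 same with a tilde, is an overlap $(P^*\xleftarrow{b_1^*}A^*\xrightarrow{b_2^*}P'^*,\,p_1^*,p_2^*)$ for which there are cospans $(e_1\colon P\to P^*,\tilde e_1\colon\tilde P\to P^*)$, $(e_2\colon P'\to P'^*,\tilde e_2\colon\tilde P'\to P'^*)$ and $(f_1\colon P^*\to Z,f_2\colon P'^*\to Z)$ in $\mathcal E'$, with $f_1,f_2\in\mathcal M$, such that $p_1^*=e_1p_1=\tilde e_1\tilde p_1$, $p_2^*=e_2p_2=\tilde e_2\tilde p_2$, and $(b_1^*,b_2^*)$, $(b_1,b_2)$, $(\tilde b_1,\tilde b_2)$ are pullbacks of $(f_1,f_2)$, $(f_1e_1,f_2e_2)$, $(f_1\tilde e_1,f_2\tilde e_2)$ respectively. \textbf{Disabling essences.} The \emph{proto-essence} of $(m\colon L\to X,m'\colon P\to X)$ under $l\colon K\to L$ consists of the pullback $L\xleftarrow{a}A\xrightarrow{b}P$ of $(m,m')$, the pullback $k\colon A'\to A$, $k'\colon A'\to K$ of $(a,l)$, and the initial pushout over $k$; it is \emph{trivial} if the context object of that initial pushout is initial. Let $L_2=P_0\xrightarrow{p_1}P_1\to\cdots\xrightarrow{p_n}P_n$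 be a path in the tree of $ac_2$ from the root to a leaf, or $n=0$. For a cospan $(e\colon L_1\to X,e_n\colon P_n\to X)\in\mathcal E'$, with $e_n\in\mathcal M$ if $n\ge1$, the proto-essence \emph{by deletion} is the proto-essence of $(e,e_n p_n\cdots p_{i+1})$ under $l_1$ for the least $i\in\{0,\dots,n\}$ for which it is non-trivial (for $i=n$ if there is none). If it is non-trivial, if $i=0$ or $P_i$ is existentially bound, and if the overlap $(L_1\xleftarrow{a}A\xrightarrow{b}P_i,\ \mathrm{id}_{L_1},\ p_i\cdots p_1)$ is embedded, by a cospan in $\mathcal E'$, in some pair of ac-disregarding transformations, then that overlap is a \emph{disabling essence} of $\rho_1$ in $\rho_2$. The proto-essence \emph{by insertion} is defined in the same way with $(R_1,r_1)$ instead of $(L_1,l_1)$ and with $i\in\{1,\dots,n\}$, $n\ge1$. If it is non-trivial, $P_i$ is universally bound, $A'\xrightarrow{b'}Q\xrightarrow{p'}P_i$ is a pushout complement of $A'\xrightarrow{k}A\xrightarrow{b}P_i$, $q\colon L_2\to Q$ satisfies $p'q=p_i\cdots p_1$, and $(L_1\xleftarrow{l_1k'}A'\xrightarrow{b'}Q,\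 \mathrm{id}_{L_1},\ q)$ is embedded, by a cospan in $\mathcal E'$, in some pair of ac-disregarding transformations, then this overlap is a \emph{disabling essence} of $\rho_1$ in $\rho_2$ as well. \textbf{Conflict essences.} $\mathrm{CEss}(\rho_1,\rho_2)$ is the smallest set of rule overlaps of $\rho_1,\rho_2$ such that (1) a disabling essence of $\rho_1$ in $\rho_2$, or of $\rho_2$ in $\rho_1$ (with the two sides of the overlap exchanged), is in the set if it is ac-conflicting or its two legs end in $L_1$ and $L_2$ themselves (with $p_1=\mathrm{id}_{L_1}$, $p_2=\mathrm{id}_{L_2}$), and (2) if $o,o'$ are in the set and are both ac-conflicting or both not ac-conflicting, then every composition of $o$ and $o'$ is in the set. \textbf{Corollary (completeness of conflict essences).} For every pair of parallel dependent transformations $(t_1,t_2)$ of an object $G$ via rules $\rho_1$ and $\rho_2$, there is a conflict essence $ce\in\mathrm{CEss}(\rho_1,\rho_2)$ that is embeddable in $(t_1,t_2)$. -/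

import Mathlib

open CategoryTheory CategoryTheory.Limits

universe w v u

namespace ConflictEssence

variable {C : Type u} [Category.{v} C]

/-! ### The categorical framework -/

/-- `(b, f₀, c)` is an initial pushout over `f : A ⟶ A'`: a pushout square with boundary
`b ∈ M` that factors, uniquely and by a pushout along `M`-morphisms, through every pushout
square over `f` whose boundary is in `M`. -/
structure IsInitialPushout (M : MorphismProperty C) {A A' B X : C}
    (f : A ⟶ A') (b : B ⟶ A) (f₀ : B ⟶ X) (c : X ⟶ A') : Prop where
  isPushout : IsPushout b f₀ f c
  boundary_mem : M b
  initial : ∀ {D E : C} (b' : D ⟶ A) (g : D ⟶ E) (c' : E ⟶ A'), M b' → IsPushout b' g f c' →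
    ∃! s : (B ⟶ D) × (X ⟶ E),
      M s.1 ∧ M s.2 ∧ s.1 ≫ b' = b ∧ s.2 ≫ c' = c ∧ IsPushout s.1 f₀ g s.2

/-- `(C, M)` is an adhesive HLR category. -/
structure IsAdhesiveHLR (M : MorphismProperty C) : Prop where
  mono : ∀ {X Y : C} (f : X ⟶ Y), M f → Mono f
  isos : ∀ {X Y : C} (f : X ⟶ Y), IsIso f → M f
  comp : ∀ {X Y Z : C} (f : X ⟶ Y) (g : Y ⟶ Z), M f → M g → M (f ≫ g)
  decomp : ∀ {X Y Z : C} (f : X ⟶ Y) (g : Y ⟶ Z), M (f ≫ g) → M g → M f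
  hasPushout : ∀ {X Y Z : C} (f : X ⟶ Y) (g : X ⟶ Z), M f → HasPushout f g
  hasPullback : ∀ {X Y Z : C} (f : X ⟶ Z) (g : Y ⟶ Z), M g → HasPullback f g
  pushout_mem : ∀ {W X Y Z : C} {f : W ⟶ X} {g : W ⟶ Y} {h : X ⟶ Z} {i : Y ⟶ Z},
    IsPushout f g h i → M f → M i
  pullback_mem : ∀ {W X Y Z : C} {f : W ⟶ X} {g : W ⟶ Y} {h : X ⟶ Z} {i : Y ⟶ Z},
    IsPullback f g h i → M i → M f
  vanKampen : ∀ {W X Y Z : C} {f : W ⟶ X} {g : W ⟶ Y} {h : X ⟶ Z} {i : Y ⟶ Z}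
    (sq : IsPushout f g h i), M f → sq.IsVanKampen

/-- A class of pairs of morphisms with common codomain. -/
abbrev CospanClass (C : Type u) [Category.{v} C] :=
  ∀ ⦃X Y Z : C⦄, (X ⟶ Z) → (Y ⟶ Z) → Prop

/-- Every cospan factors as a cospan in `E` followed by a morphism in `M`, uniquely up to
unique isomorphism. -/
structure HasUniqueFactorization (M : MorphismProperty C) (E : CospanClass C) : Prop where
  exists_factor : ∀ {X Y Z : C} (f : X ⟶ Z) (g : Y ⟶ Z),
    ∃ (I : C) (e : X ⟶ I) (e' : Y ⟶ I) (m : I ⟶ Z), E e e' ∧ M m ∧ e ≫ m = f ∧ e' ≫ m = g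
  unique : ∀ {X Y Z I J : C} (e : X ⟶ I) (e' : Y ⟶ I) (m : I ⟶ Z)
    (d : X ⟶ J) (d' : Y ⟶ J) (n : J ⟶ Z), E e e' → M m → E d d' → M n →
    e ≫ m = d ≫ n → e' ≫ m = d' ≫ n →
    ∃! i : I ≅ J, e ≫ i.hom = d ∧ e' ≫ i.hom = d' ∧ i.hom ≫ n = m

/-- The ambient assumptions on `(C, M)` and the class `E` of cospans. -/
structure Framework (M : MorphismProperty C) (E : CospanClass C) : Prop where
  adhesive : IsAdhesiveHLR M
  hasPullbacks : HasPullbacks C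
  initialPushouts : ∀ {A A' : C} (f : A ⟶ A'), M f →
    ∃ (B X : C) (b : B ⟶ A) (f₀ : B ⟶ X) (c : X ⟶ A'), IsInitialPushout M f b f₀ c
  initialObject : ∃ I : C, Nonempty (IsInitial I) ∧ ∀ (A : C) (f : I ⟶ A), M f
  factorization : HasUniqueFactorization M E

/-! ### Nested conditions -/

inductive Quantifier
  | ex
  | all

/-- Nested conditions over an object, with negations pushed inward: built from conjunctions and
disjunctions (the empty ones are `true` and `false`) and the two quantifiers. -/
inductive Condition : C → Type (max u v (w + 1))
  | conj {P : C} {ι : Type w} (c : ι → Condition P) : Condition P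
  | disj {P : C} {ι : Type w} (c : ι → Condition P) : Condition P
  | quant {P Q : C} (q : Quantifier) (p : P ⟶ Q) (d : Condition Q) : Condition P

namespace Condition

/-- Satisfaction of a condition by a morphism; quantified occurrences are in `M`. -/
def Sat (M : MorphismProperty C) : {P : C} → Condition.{w} P → {G : C} → (P ⟶ G) → Prop
  | _, conj c, _, x => ∀ i, (c i).Sat M x
  | _, disj c, _, x => ∃ i, (c i).Sat M x
  | _, quant (Q := Q) .ex p d, G, x => ∃ y : Q ⟶ G, M y ∧ p ≫ y = x ∧ d.Sat M y
  | _, quant (Q := Q) .all p d, G, x => ∀ y : Q ⟶ G, M y → p ≫ y = x → d.Sat M y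

/-- All morphisms in the condition are in `M`. -/
def AllMem (M : MorphismProperty C) : {P : C} → Condition.{w} P → Prop
  | _, conj c => ∀ i, (c i).AllMem M
  | _, disj c => ∀ i, (c i).AllMem M
  | _, quant _ p d => M p ∧ d.AllMem M

/-- `M`-normal form: all morphisms in the condition are in `M`, except possibly those that
start at the object over which the condition is defined. -/
def IsNormal (M : MorphismProperty C) : {P : C} → Condition.{w} P → Prop
  | _, conj c => ∀ i, (c i).IsNormal M
  | _, disj c => ∀ i, (c i).IsNormal M
  | _, quant _ _ d => d.AllMem M

/-- The edges at the root of the tree of a condition: `Edge c q p d` says that `q (p, d)` is one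
of the quantified conditions of which `c` is a Boolean combination. -/
inductive Edge : {P Q : C} → Condition.{w} P → Quantifier → (P ⟶ Q) → Condition.{w} Q → Prop
  | quant {P Q : C} (q : Quantifier) (p : P ⟶ Q) (d : Condition Q) : Edge (quant q p d) q p d
  | conj {P Q : C} {ι : Type w} (c : ι → Condition P) (i : ι) {q : Quantifier} {p : P ⟶ Q}
      {d : Condition Q} : Edge (c i) q p d → Edge (conj c) q p d
  | disj {P Q : C} {ι : Type w} (c : ι → Condition P) (i : ι) {q : Quantifier} {p : P ⟶ Q}
      {d : Condition Q} : Edge (c i) q p d → Edge (disj c) q p d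

end Condition

/-- Paths `P = P₀ ⟶ P₁ ⟶ ⋯ ⟶ Pₙ = R` in the tree of a condition over `P`, starting at the root. -/
inductive TreePath : {P : C} → Condition.{w} P → C → Type (max u v (w + 1))
  | nil {P : C} (c : Condition P) : TreePath c P
  | cons {P Q R : C} {c : Condition P} {q : Quantifier} {p : P ⟶ Q} {d : Condition Q} :
      c.Edge q p d → TreePath d R → TreePath c R

namespace TreePath

/-- The number `n` of edges. -/
def length : {P R : C} → {c : Condition.{w} P} → TreePath c R → ℕ
  | _, _, _, nil _ => 0
  | _, _, _, cons _ π => π.length + 1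

/-- The last node of the path is a leaf of the tree. -/
def EndsInLeaf : {P R : C} → {c : Condition.{w} P} → TreePath c R → Prop
  | P, _, _, nil c => ∀ (Q : C) (q : Quantifier) (p : P ⟶ Q) (d : Condition Q), ¬ c.Edge q p d
  | _, _, _, cons _ π => π.EndsInLeaf

/-- The object `Pᵢ` (for `i` at most the length). -/
def obj : {P R : C} → {c : Condition.{w} P} → TreePath c R → ℕ → C
  | P, _, _, nil _, _ => P
  | P, _, _, cons _ _, 0 => P
  | _, _, _, cons _ π, i + 1 => π.obj i

/-- The composite `pₙ ∘ ⋯ ∘ p₁ : P₀ ⟶ Pₙ`. -/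
def comp : {P R : C} → {c : Condition.{w} P} → TreePath c R → (P ⟶ R)
  | P, _, _, nil _ => 𝟙 P
  | _, _, _, cons (p := p) _ π => p ≫ π.comp

/-- The composite `pᵢ ∘ ⋯ ∘ p₁ : P₀ ⟶ Pᵢ`. -/
def toObj : {P R : C} → {c : Condition.{w} P} → (π : TreePath c R) → (i : ℕ) → (P ⟶ π.obj i)
  | P, _, _, nil _, _ => 𝟙 P
  | P, _, _, cons _ _, 0 => 𝟙 P
  | _, _, _, cons (p := p) _ π, i + 1 => p ≫ π.toObj i

/-- The composite `pₙ ∘ ⋯ ∘ pᵢ₊₁ : Pᵢ ⟶ Pₙ`. -/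
def fromObj : {P R : C} → {c : Condition.{w} P} → (π : TreePath c R) → (i : ℕ) → (π.obj i ⟶ R)
  | P, _, _, nil _, _ => 𝟙 P
  | _, _, _, cons (p := p) _ π, 0 => p ≫ π.comp
  | _, _, _, cons _ π, i + 1 => π.fromObj i

/-- `π.BoundBy q i`: `i ≥ 1` and the object `Pᵢ` is bound by the quantifier `q`. -/
def BoundBy (q : Quantifier) : {P R : C} → {c : Condition.{w} P} → TreePath c R → ℕ → Prop
  | _, _, _, nil _, _ => False
  | _, _, _, cons _ _, 0 => False
  | _, _, _, cons (q := q') _ _, 1 => q' = q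
  | _, _, _, cons _ π, i + 2 => π.BoundBy q (i + 1)

end TreePath

/-! ### Rules and transformations -/

/-- A rule `L ↩ K ↪ R` with an application condition over `L`. -/
structure Rule (M : MorphismProperty C) where
  L : C
  K : C
  R : C
  l : K ⟶ L
  r : K ⟶ R
  l_mem : M l
  r_mem : M r
  ac : Condition.{w} L
  ac_normal : ac.IsNormal M

variable {M : MorphismProperty C}

/-- An ac-disregarding (double-pushout) transformation of `G` via `ρ`, with match `m`, context
`D`, result `H` and comatch `n`. (`g` and `h` are in `M`, as pushouts of `ρ.l` and `ρ.r`.) -/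
structure PlainTransformation (ρ : Rule.{w} M) (G : C) where
  D : C
  H : C
  m : ρ.L ⟶ G
  k : ρ.K ⟶ D
  n : ρ.R ⟶ H
  g : D ⟶ G
  h : D ⟶ H
  left : IsPushout ρ.l k m g
  right : IsPushout ρ.r k n h

/-- A transformation: the match satisfies the application condition. -/
structure Transformation (ρ : Rule.{w} M) (G : C) extends PlainTransformation ρ G where
  sat : ρ.ac.Sat M m

/-- Parallel independence ac-disregarding. -/
def PlainIndependent {ρ₁ ρ₂ : Rule.{w} M} {G : C}
    (t₁ : PlainTransformation ρ₁ G) (t₂ : PlainTransformation ρ₂ G) : Prop :=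
  ∃ (d₁ : ρ₂.L ⟶ t₁.D) (d₂ : ρ₁.L ⟶ t₂.D), d₁ ≫ t₁.g = t₂.m ∧ d₂ ≫ t₂.g = t₁.m

def ParallelIndependent {ρ₁ ρ₂ : Rule.{w} M} {G : C}
    (t₁ : Transformation ρ₁ G) (t₂ : Transformation ρ₂ G) : Prop :=
  ∃ (d₁ : ρ₂.L ⟶ t₁.D) (d₂ : ρ₁.L ⟶ t₂.D), d₁ ≫ t₁.g = t₂.m ∧ d₂ ≫ t₂.g = t₁.m ∧
    ρ₂.ac.Sat M (d₁ ≫ t₁.h) ∧ ρ₁.ac.Sat M (d₂ ≫ t₂.h)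

def ParallelDependent {ρ₁ ρ₂ : Rule.{w} M} {G : C}
    (t₁ : Transformation ρ₁ G) (t₂ : Transformation ρ₂ G) : Prop :=
  ¬ ParallelIndependent t₁ t₂

/-! ### Rule overlaps -/

/-- An overlap of two rules with left-hand sides `L₁` and `L₂`. -/
structure RuleOverlap (L₁ L₂ : C) where
  P₁ : C
  P₂ : C
  A : C
  b₁ : A ⟶ P₁
  b₂ : A ⟶ P₂
  p₁ : L₁ ⟶ P₁
  p₂ : L₂ ⟶ P₂

namespace RuleOverlap

/-- The same overlap with the roles of the rules exchanged. -/
def flip {L₁ L₂ : C} (o : RuleOverlap L₁ L₂) : RuleOverlap L₂ L₁ :=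
  ⟨o.P₂, o.P₁, o.A, o.b₂, o.b₁, o.p₂, o.p₁⟩

/-- `(x₁, x₂)` is an embedding of the overlap in a pair of transformations with matches
`m₁` and `m₂`. -/
def IsEmbedding {L₁ L₂ G : C} (o : RuleOverlap L₁ L₂) (m₁ : L₁ ⟶ G) (m₂ : L₂ ⟶ G)
    (x₁ : o.P₁ ⟶ G) (x₂ : o.P₂ ⟶ G) : Prop :=
  o.p₁ ≫ x₁ = m₁ ∧ o.p₂ ≫ x₂ = m₂ ∧ IsPullback o.b₁ o.b₂ x₁ x₂

variable {ρ₁ ρ₂ : Rule.{w} M}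

/-- The overlap is embeddable in the transformation pair. -/
def EmbedsIn (o : RuleOverlap ρ₁.L ρ₂.L) {G : C}
    (t₁ : PlainTransformation ρ₁ G) (t₂ : PlainTransformation ρ₂ G) : Prop :=
  ∃ (x₁ : o.P₁ ⟶ G) (x₂ : o.P₂ ⟶ G), o.IsEmbedding t₁.m t₂.m x₁ x₂

/-- The two legs of the overlap end in the left-hand sides of the rules themselves. -/
def IsPlain {L₁ L₂ : C} (o : RuleOverlap L₁ L₂) : Prop :=
  ∃ (A : C) (b₁ : A ⟶ L₁) (b₂ : A ⟶ L₂), o = ⟨L₁, L₂, A, b₁, b₂, 𝟙 L₁, 𝟙 L₂⟩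

/-- The overlap is ac-conflicting. -/
def AcConflicting (ρ₁ ρ₂ : Rule.{w} M) (o : RuleOverlap ρ₁.L ρ₂.L) : Prop :=
  ∃ (G : C) (t₁ : PlainTransformation ρ₁ G) (t₂ : PlainTransformation ρ₂ G),
    PlainIndependent t₁ t₂ ∧ o.EmbedsIn t₁ t₂

/-- The overlap is embedded, via a cospan in `E`, in an ac-disregarding transformation pair. -/
def Realizable (E : CospanClass C) (ρ₁ ρ₂ : Rule.{w} M) (o : RuleOverlap ρ₁.L ρ₂.L) : Prop :=
  ∃ (G : C) (e₁ : o.P₁ ⟶ G) (e₂ : o.P₂ ⟶ G)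
    (t₁ : PlainTransformation ρ₁ G) (t₂ : PlainTransformation ρ₂ G),
    E e₁ e₂ ∧ o.IsEmbedding t₁.m t₂.m e₁ e₂

/-- `s` is a composition of the overlaps `o` and `o'`. -/
def IsComposition (M : MorphismProperty C) (E : CospanClass C) {L₁ L₂ : C}
    (o o' s : RuleOverlap L₁ L₂) : Prop :=
  ∃ (e₁ : o.P₁ ⟶ s.P₁) (e₁' : o'.P₁ ⟶ s.P₁) (e₂ : o.P₂ ⟶ s.P₂) (e₂' : o'.P₂ ⟶ s.P₂)
    (Z : C) (f₁ : s.P₁ ⟶ Z) (f₂ : s.P₂ ⟶ Z),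
    E e₁ e₁' ∧ E e₂ e₂' ∧ E f₁ f₂ ∧ M f₁ ∧ M f₂ ∧
    o.p₁ ≫ e₁ = s.p₁ ∧ o'.p₁ ≫ e₁' = s.p₁ ∧ o.p₂ ≫ e₂ = s.p₂ ∧ o'.p₂ ≫ e₂' = s.p₂ ∧
    IsPullback s.b₁ s.b₂ f₁ f₂ ∧
    IsPullback o.b₁ o.b₂ (e₁ ≫ f₁) (e₂ ≫ f₂) ∧
    IsPullback o'.b₁ o'.b₂ (e₁' ≫ f₁) (e₂' ≫ f₂)

end RuleOverlap

/-! ### Proto-essences and disabling essences -/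

/-- A proto-essence for `(m₁ : L ⟶ G, m₂ : P ⟶ G)` under `l : K ⟶ L`: the pullback `A` of the two
morphisms, the pullback `A'` of `A` along `l`, and the initial pushout over `A' ⟶ A`, whose
context object is the essence object. -/
structure ProtoEssence (M : MorphismProperty C) {K L P G : C} (l : K ⟶ L)
    (m₁ : L ⟶ G) (m₂ : P ⟶ G) where
  A : C
  a₁ : A ⟶ L
  a₂ : A ⟶ P
  isPullback : IsPullback a₁ a₂ m₁ m₂
  A' : C
  k : A' ⟶ A
  k' : A' ⟶ K
  isPullback' : IsPullback k k' a₁ l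
  boundary : C
  essence : C
  b : boundary ⟶ A'
  b₀ : boundary ⟶ essence
  c : essence ⟶ A
  isInitialPushout : IsInitialPushout M k b b₀ c

/-- The span `(a₁ ∘ c, a₂ ∘ c)` consists of the two morphisms out of the initial object. -/
def ProtoEssence.Trivial {K L P G : C} {l : K ⟶ L} {m₁ : L ⟶ G} {m₂ : P ⟶ G}
    (e : ProtoEssence M l m₁ m₂) : Prop :=
  Nonempty (IsInitial e.essence)

/-- `LevelEssence l e₁ π eₙ s i j e`: `e` is the proto-essence at level `i` of the cospan
`(e₁ : L ⟶ X, eₙ : Pₙ ⟶ X)` along the path `π`, with the recursion starting at level `s`; it is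
computed from `e₁` and the object `Pⱼ` of the path. The next level only replaces trivial
proto-essences. -/
inductive LevelEssence {K L X P₀ Pₙ : C} {c₀ : Condition.{w} P₀} (l : K ⟶ L) (e₁ : L ⟶ X)
    (π : TreePath c₀ Pₙ) (eₙ : Pₙ ⟶ X) (s : ℕ) :
    ℕ → (j : ℕ) → ProtoEssence M l e₁ (π.fromObj j ≫ eₙ) → Prop
  | start (e : ProtoEssence M l e₁ (π.fromObj s ≫ eₙ)) : LevelEssence l e₁ π eₙ s s s e
  | keep {i j : ℕ} {e : ProtoEssence M l e₁ (π.fromObj j ≫ eₙ)} :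
      LevelEssence l e₁ π eₙ s i j e → ¬ e.Trivial → LevelEssence l e₁ π eₙ s (i + 1) j e
  | next {i j : ℕ} {e : ProtoEssence M l e₁ (π.fromObj j ≫ eₙ)} :
      LevelEssence l e₁ π eₙ s i j e → e.Trivial →
      (e' : ProtoEssence M l e₁ (π.fromObj (i + 1) ≫ eₙ)) →
      LevelEssence l e₁ π eₙ s (i + 1) (i + 1) e'

/-- The data from which proto-essences are computed: a path `π` from the root to `Pₙ`, which is a
leaf or the root itself, and a cospan `(e₁ : L ⟶ X, eₙ : Pₙ ⟶ X)` in `E`, where `eₙ ∈ M` if `Pₙ` is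
not the root (matches of left-hand sides need not be in `M`). -/
def AdmissibleCospan (M : MorphismProperty C) (E : CospanClass C) {L X P₀ Pₙ : C}
    {c₀ : Condition.{w} P₀} (e₁ : L ⟶ X) (π : TreePath c₀ Pₙ) (eₙ : Pₙ ⟶ X) : Prop :=
  (π.EndsInLeaf ∨ π.length = 0) ∧ E e₁ eₙ ∧ (π.length ≠ 0 → M eₙ)

/-- Disabling essences by deletion of `ρ₁` in `ρ₂`, as rule overlaps. -/
inductive IsDeletionEssence (E : CospanClass C) (ρ₁ ρ₂ : Rule.{w} M) :
    RuleOverlap ρ₁.L ρ₂.L → Prop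
  | mk {X Pₙ : C} (e₁ : ρ₁.L ⟶ X) (π : TreePath ρ₂.ac Pₙ) (eₙ : Pₙ ⟶ X) (j : ℕ)
      (e : ProtoEssence M ρ₁.l e₁ (π.fromObj j ≫ eₙ)) :
      AdmissibleCospan M E e₁ π eₙ →
      LevelEssence ρ₁.l e₁ π eₙ 0 π.length j e →
      RuleOverlap.Realizable E ρ₁ ρ₂
        ⟨ρ₁.L, π.obj j, e.A, e.a₁, e.a₂, 𝟙 ρ₁.L, π.toObj j⟩ →
      (j = 0 ∨ π.BoundBy .ex j) →
      ¬ e.Trivial →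
      IsDeletionEssence E ρ₁ ρ₂ ⟨ρ₁.L, π.obj j, e.A, e.a₁, e.a₂, 𝟙 ρ₁.L, π.toObj j⟩

/-- Disabling essences by insertion of `ρ₁` in `ρ₂`, as rule overlaps: a proto-essence `e` for the
right-hand side of `ρ₁` (the recursion starts at level 1) is shifted over `ρ₁` by means of a
pushout complement `Q` of `A' ⟶ A ⟶ Pⱼ`, through which the morphism from `ρ₂.L` has to factor. -/
inductive IsInsertionEssence (E : CospanClass C) (ρ₁ ρ₂ : Rule.{w} M) :
    RuleOverlap ρ₁.L ρ₂.L → Prop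
  | mk {X Pₙ : C} (e₁ : ρ₁.R ⟶ X) (π : TreePath ρ₂.ac Pₙ) (eₙ : Pₙ ⟶ X) (j : ℕ)
      (e : ProtoEssence M ρ₁.r e₁ (π.fromObj j ≫ eₙ))
      (Q : C) (b' : e.A' ⟶ Q) (p' : Q ⟶ π.obj j) (p₂ : ρ₂.L ⟶ Q) :
      AdmissibleCospan M E e₁ π eₙ →
      LevelEssence ρ₁.r e₁ π eₙ 1 π.length j e →
      IsPushout e.k b' e.a₂ p' →
      p₂ ≫ p' = π.toObj j →
      RuleOverlap.Realizable E ρ₁ ρ₂ ⟨ρ₁.L, Q, e.A', e.k' ≫ ρ₁.l, b', 𝟙 ρ₁.L, p₂⟩ →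
      π.BoundBy .all j →
      ¬ e.Trivial →
      IsInsertionEssence E ρ₁ ρ₂ ⟨ρ₁.L, Q, e.A', e.k' ≫ ρ₁.l, b', 𝟙 ρ₁.L, p₂⟩

/-- The set of disabling essences of `ρ₁` in `ρ₂`. -/
def disablingEssences (E : CospanClass C) (ρ₁ ρ₂ : Rule.{w} M) : Set (RuleOverlap ρ₁.L ρ₂.L) :=
  {o | IsDeletionEssence E ρ₁ ρ₂ o ∨ IsInsertionEssence E ρ₁ ρ₂ o}

/-! ### Conflict essences -/

inductive IsConflictEssence (E : CospanClass C) (ρ₁ ρ₂ : Rule.{w} M) :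
    RuleOverlap ρ₁.L ρ₂.L → Prop
  | disabling (o : RuleOverlap ρ₁.L ρ₂.L) :
      (o ∈ disablingEssences E ρ₁ ρ₂ ∨ o.flip ∈ disablingEssences E ρ₂ ρ₁) →
      (o.AcConflicting ρ₁ ρ₂ ∨ o.IsPlain) →
      IsConflictEssence E ρ₁ ρ₂ o
  | composition (o o' s : RuleOverlap ρ₁.L ρ₂.L) :
      IsConflictEssence E ρ₁ ρ₂ o → IsConflictEssence E ρ₁ ρ₂ o' →
      (o.AcConflicting ρ₁ ρ₂ ↔ o'.AcConflicting ρ₁ ρ₂) →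
      RuleOverlap.IsComposition M E o o' s →
      IsConflictEssence E ρ₁ ρ₂ s

/-- The set `CEss(ρ₁, ρ₂)` of conflict essences. -/
def conflictEssences (E : CospanClass C) (ρ₁ ρ₂ : Rule.{w} M) : Set (RuleOverlap ρ₁.L ρ₂.L) :=
  {o | IsConflictEssence E ρ₁ ρ₂ o}

end ConflictEssence

/-! In a pushout `G` of `l : K ⟶ L` in `M` and `k : K ⟶ D`, a morphism `P ⟶ G` factors through `D`
exactly when the intersection of `L` and `P` over `G` lies in `K`, that is, when the proto-essence
is trivial (`trivial_iff_factors`). Non-trivial proto-essences thus detect what a transformation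
deletes or inserts.

Dependence has two sources. Either a match does not factor through the context of the other
transformation, and the proto-essence at level 0 is already a disabling essence between the
left-hand sides (`exists_plain_disabling`). Or both matches are inherited, but an application
condition that holds in `G` fails in `H`. Comparing the two evaluations down the tree yields a first
occurrence not inherited from `D`: an existential witness in `G` or a universal counterexample in
`H` (`Condition.breaks_of_sat_of_not_sat`). All nodes above it are inherited, so the recursion on
levels stops exactly there (`exists_levelEssence`). This gives an essence by deletion, or one by
insertion after pulling back to `D`; it is ac-conflicting, witnessed by the given pair.

In both cases a single disabling essence suffices, and compositions are not needed. -/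

namespace ConflictEssence

section

variable {C : Type u} [Category.{v} C] {M : MorphismProperty C}

/-! ### Pushouts along `M`-morphisms -/

/-- Two cospans that become equal after monomorphisms have the same pullbacks. -/
theorem isPullback_transfer {A L P X Y G : C} {a₁ : A ⟶ L} {a₂ : A ⟶ P} {f : L ⟶ X} {f' : P ⟶ X}
    {m : L ⟶ G} {m' : P ⟶ G} (i : X ⟶ Y) (j : G ⟶ Y) [Mono i] [Mono j]
    (h : f ≫ i = m ≫ j) (h' : f' ≫ i = m' ≫ j) (sq : IsPullback a₁ a₂ f f') :
    IsPullback a₁ a₂ m m' := by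
  have w : a₁ ≫ m = a₂ ≫ m' := by
    rw [← cancel_mono j, Category.assoc, Category.assoc, ← h, ← h', sq.w_assoc]
  refine ⟨⟨w⟩, ⟨PullbackCone.IsLimit.mk w (fun s => sq.lift s.fst s.snd ?_) ?_ ?_ ?_⟩⟩
  · rw [← cancel_mono i, Category.assoc, Category.assoc, h, h', s.condition_assoc]
  · intro s; simp
  · intro s; simp
  · intro s t h₁ h₂
    apply sq.hom_ext <;> simp [h₁, h₂]

/-- Pushouts along `M`-morphisms are pullbacks. -/
theorem IsAdhesiveHLR.isPullback (hM : IsAdhesiveHLR M) {K L D G : C} {l : K ⟶ L} {k : K ⟶ D}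
    {m : L ⟶ G} {g : D ⟶ G} (po : IsPushout l k m g) (hl : M l) : IsPullback l k m g :=
  haveI := hM.mono l hl
  (hM.vanKampen po hl).isPullback_of_mono_left

/-- Pulling back a pushout along an `M`-morphism gives a pushout. -/
theorem IsAdhesiveHLR.isPushout_pullback (hM : IsAdhesiveHLR M) {K L D G P A A' Q : C}
    {l : K ⟶ L} {k : K ⟶ D} {m : L ⟶ G} {g : D ⟶ G} (po : IsPushout l k m g) (hl : M l)
    {x : P ⟶ G} {a₁ : A ⟶ L} {a₂ : A ⟶ P} (ha : IsPullback a₁ a₂ m x)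
    {κ : A' ⟶ A} {κ' : A' ⟶ K} (hκ : IsPullback κ κ' a₁ l)
    {q₁ : Q ⟶ P} {q₂ : Q ⟶ D} (hq : IsPullback q₁ q₂ x g) :
    ∃ b : A' ⟶ Q, IsPushout κ b a₂ q₁ ∧ IsPullback b κ' q₂ k := by
  have outer : IsPullback (κ ≫ a₂) κ' x (k ≫ g) := by
    rw [← po.w]
    exact hκ.flip.paste_vert ha |>.flip
  have w : (κ ≫ a₂) ≫ x = (κ' ≫ k) ≫ g := by simpa using outer.w
  have hb : IsPullback (hq.lift _ _ w) κ' q₂ k := by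
    refine IsPullback.of_right ?_ ?_ hq
    · simpa using outer
    · simp
  -- The cube over `po` has only pullbacks as vertical faces, so its top face is a pushout.
  exact ⟨_, (hM.vanKampen po hl κ _ a₂ q₁ κ' a₁ q₂ x hκ hb ⟨ha.w.symm⟩ ⟨hq.w⟩ ⟨by simp⟩).2
    ⟨ha.flip, hq⟩, hb⟩

/-- A morphism into a pushout along an `M`-morphism factors through the second leg if and only if
the pullback of the `M`-morphism to its intersection with the first leg is an isomorphism. -/
theorem IsAdhesiveHLR.isIso_iff_factors (hM : IsAdhesiveHLR M) [HasPullbacks C]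
    {K L D G P A A' : C}
    {l : K ⟶ L} {k : K ⟶ D} {m : L ⟶ G} {g : D ⟶ G} (po : IsPushout l k m g) (hl : M l)
    {x : P ⟶ G} {a₁ : A ⟶ L} {a₂ : A ⟶ P} (ha : IsPullback a₁ a₂ m x)
    {κ : A' ⟶ A} {κ' : A' ⟶ K} (hκ : IsPullback κ κ' a₁ l) :
    IsIso κ ↔ ∃ d : P ⟶ D, d ≫ g = x := by
  have hq := IsPullback.of_hasPullback x g
  constructor
  · intro h
    obtain ⟨b, hb, -⟩ := hM.isPushout_pullback po hl ha hκ hq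
    have : IsIso (pullback.fst x g) := hb.isIso_inr_of_isIso
    exact ⟨inv (pullback.fst x g) ≫ pullback.snd x g, by
      rw [Category.assoc, ← pullback.condition, IsIso.inv_hom_id_assoc]⟩
  · rintro ⟨d, hd⟩
    have := hM.mono l hl
    -- As `po` is also a pullback, `a₁` factors through `l`; this yields a section of the
    -- monomorphism `κ`.
    have w : a₁ ≫ m = (a₂ ≫ d) ≫ g := by rw [ha.w, Category.assoc, hd]
    have pb := hM.isPullback po hl
    have w' : 𝟙 A ≫ a₁ = pb.lift a₁ (a₂ ≫ d) w ≫ l := by simp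
    have hs : hκ.lift _ _ w' ≫ κ = 𝟙 A := by simp
    have : Mono κ := hM.mono κ (hM.pullback_mem hκ hl)
    have : IsSplitEpi κ := ⟨⟨⟨_, hs⟩⟩⟩
    exact isIso_of_mono_of_isSplitEpi κ

/-! ### Initial pushouts and triviality of proto-essences -/

namespace Framework

variable {E : CospanClass C} (hC : Framework M E)
include hC

/-- The context object of an initial pushout over an `M`-morphism is initial if and only if the
morphism is an isomorphism. -/
theorem isInitial_context_iff {A A' B X : C} {f : A ⟶ A'} {b : B ⟶ A} {f₀ : B ⟶ X} {c : X ⟶ A'}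
    (hf : M f) (ip : IsInitialPushout M f b f₀ c) : Nonempty (IsInitial X) ↔ IsIso f := by
  obtain ⟨I, ⟨hI⟩, hIM⟩ := hC.initialObject
  constructor
  · rintro ⟨hX⟩
    have hB : M f₀ :=
      hC.adhesive.pullback_mem (hC.adhesive.isPullback ip.isPushout ip.boundary_mem).flip hf
    have : Mono f₀ := hC.adhesive.mono f₀ hB
    have : IsSplitEpi f₀ := ⟨⟨⟨hX.to B, hX.hom_ext _ _⟩⟩⟩
    have : IsIso f₀ := isIso_of_mono_of_isSplitEpi f₀
    exact ip.isPushout.isIso_inl_of_isIso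
  · intro h
    -- When `f` is an isomorphism, the square from `𝟙 I` to `f` is a pushout; initiality then gives
    -- a morphism `X ⟶ I` in `M`, which is split by `I` being initial.
    obtain ⟨s, ⟨-, hs, -⟩, -⟩ := ip.initial (hI.to A) (𝟙 I) (hI.to A') (hIM _ _)
      (IsPushout.of_vert_isIso ⟨hI.hom_ext _ _⟩)
    have : Mono s.2 := hC.adhesive.mono _ hs
    have : IsSplitEpi s.2 := ⟨⟨⟨hI.to X, hI.hom_ext _ _⟩⟩⟩
    have : IsIso s.2 := isIso_of_mono_of_isSplitEpi s.2
    exact ⟨hI.ofIso (asIso s.2).symm⟩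

theorem trivial_iff {K L P G : C} {l : K ⟶ L} (hl : M l) {m₁ : L ⟶ G} {m₂ : P ⟶ G}
    (e : ProtoEssence M l m₁ m₂) : e.Trivial ↔ IsIso e.k :=
  hC.isInitial_context_iff (hC.adhesive.pullback_mem e.isPullback' hl) e.isInitialPushout

theorem nonempty_protoEssence {K L P G : C} {l : K ⟶ L} (hl : M l) (m₁ : L ⟶ G) (m₂ : P ⟶ G) :
    Nonempty (ProtoEssence M l m₁ m₂) := by
  have := hC.hasPullbacks
  have h := IsPullback.of_hasPullback (pullback.fst m₁ m₂) l
  obtain ⟨B, X, b, f₀, c, hi⟩ := hC.initialPushouts _ (hC.adhesive.pullback_mem h hl)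
  exact ⟨⟨_, _, _, IsPullback.of_hasPullback m₁ m₂, _, _, _, h, B, X, b, f₀, c, hi⟩⟩

/-- The proto-essence of a cospan that agrees, up to monomorphisms, with a match `m` and a
morphism `x` is trivial if and only if `x` factors through the context of the pushout. -/
theorem trivial_iff_factors {K L D G P X Y : C} {l : K ⟶ L} {k : K ⟶ D} {m : L ⟶ G} {g : D ⟶ G}
    (po : IsPushout l k m g) (hl : M l) {f : L ⟶ X} {f' : P ⟶ X} (e : ProtoEssence M l f f')
    {x : P ⟶ G} (i : X ⟶ Y) (j : G ⟶ Y) (hi : M i) (hj : M j)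
    (h : f ≫ i = m ≫ j) (h' : f' ≫ i = x ≫ j) : e.Trivial ↔ ∃ d : P ⟶ D, d ≫ g = x := by
  have := hC.hasPullbacks
  have := hC.adhesive.mono i hi
  have := hC.adhesive.mono j hj
  rw [hC.trivial_iff hl, hC.adhesive.isIso_iff_factors po hl
    (isPullback_transfer i j h h' e.isPullback) e.isPullback']

/-! ### Restriction of transformations -/

/-- A plain transformation restricts along any `M`-morphism through which its match factors. -/
theorem exists_restriction {ρ : Rule.{w} M} {G X : C} (t : PlainTransformation ρ G) (x : X ⟶ G)
    (hx : M x) (m : ρ.L ⟶ X) (h : m ≫ x = t.m) : ∃ t' : PlainTransformation ρ X, t'.m = m := by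
  have := hC.hasPullbacks
  have := hC.adhesive.mono x hx
  -- Since `x` is a monomorphism, the pullback of the match along `x` is `m` itself; hence the
  -- pulled back left square again starts with `ρ.l`.
  have ha : IsPullback (𝟙 ρ.L) m t.m x := by
    refine ⟨⟨by simp [h]⟩, ⟨PullbackCone.IsLimit.mk _ (fun s => s.fst) ?_ ?_ ?_⟩⟩
    · intro s; simp
    · intro s
      rw [← cancel_mono x, Category.assoc, h, s.condition]
    · intro s t h₁ h₂
      simpa using h₁
  have hκ : IsPullback ρ.l (𝟙 ρ.K) (𝟙 ρ.L) ρ.l := IsPullback.of_vert_isIso ⟨by simp⟩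
  obtain ⟨b, hb, -⟩ := hC.adhesive.isPushout_pullback t.left ρ.l_mem ha hκ
    (IsPullback.of_hasPullback x t.g)
  have := hC.adhesive.hasPushout ρ.r b ρ.r_mem
  exact ⟨⟨_, _, m, b, _, _, _, hb, IsPushout.of_hasPushout ρ.r b⟩, rfl⟩

/-- An embeddable overlap is embedded by a cospan in `E` in some pair of plain transformations. -/
theorem realizable {ρ₁ ρ₂ : Rule.{w} M} {o : RuleOverlap ρ₁.L ρ₂.L} {G : C}
    {t₁ : PlainTransformation ρ₁ G} {t₂ : PlainTransformation ρ₂ G} (h : o.EmbedsIn t₁ t₂) :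
    o.Realizable E ρ₁ ρ₂ := by
  obtain ⟨x₁, x₂, h₁, h₂, hp⟩ := h
  obtain ⟨X, e₁, e₂, x, he, hx, rfl, rfl⟩ := hC.factorization.exists_factor x₁ x₂
  obtain ⟨s₁, hs₁⟩ := hC.exists_restriction t₁ x hx (o.p₁ ≫ e₁) (by simpa using h₁)
  obtain ⟨s₂, hs₂⟩ := hC.exists_restriction t₂ x hx (o.p₂ ≫ e₂) (by simpa using h₂)
  have := hC.adhesive.mono x hx
  refine ⟨X, e₁, e₂, s₁, s₂, he, hs₁.symm, hs₂.symm, ?_⟩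
  exact isPullback_transfer (𝟙 _) x (by simp) (by simp) hp

end Framework

theorem PlainTransformation.g_mem (hM : IsAdhesiveHLR M) {ρ : Rule.{w} M} {G : C}
    (t : PlainTransformation ρ G) : M t.g := hM.pushout_mem t.left ρ.l_mem

theorem PlainTransformation.h_mem (hM : IsAdhesiveHLR M) {ρ : Rule.{w} M} {G : C}
    (t : PlainTransformation ρ G) : M t.h := hM.pushout_mem t.right ρ.r_mem

/-! ### Paths in conditions -/

theorem TreePath.le_length_of_boundBy {P R : C} {c : Condition.{w} P} (π : TreePath c R)
    {q : Quantifier} {j : ℕ} (h : π.BoundBy q j) : 1 ≤ j ∧ j ≤ π.length := by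
  induction π generalizing j with
  | nil => exact h.elim
  | cons e π ih =>
    match j, h with
    | 1, _ => exact ⟨le_rfl, by simp [length]⟩
    | j + 2, h => exact ⟨by omega, by have := (ih h).2; simp only [length]; omega⟩

namespace Condition

theorem Edge.allMem {P Q : C} {c : Condition.{w} P} {q : Quantifier} {p : P ⟶ Q}
    {d : Condition Q} (e : c.Edge q p d) (h : c.AllMem M) : M p ∧ d.AllMem M := by
  induction e with
  | quant => exact h
  | conj c i e ih => exact ih (h i)
  | disj c i e ih => exact ih (h i)

/-- Inductions over normal conditions need this to continue below a quantifier. -/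
theorem AllMem.isNormal {P : C} {c : Condition.{w} P} (h : c.AllMem M) : c.IsNormal M := by
  induction c with
  | conj c ih => exact fun i => ih i (h i)
  | disj c ih => exact fun i => ih i (h i)
  | quant q p d => exact h.2

/-- Below every node of the tree of a condition there is a leaf. -/
theorem exists_path_endsInLeaf {P : C} (c : Condition.{w} P) :
    ∃ (R : C) (π : TreePath c R), π.EndsInLeaf := by
  -- Conjunctions and disjunctions create no nodes, so the induction runs over the edges that leave
  -- the root.
  suffices h : ∀ (Q : C) (q : Quantifier) (p : P ⟶ Q) (d : Condition Q), c.Edge q p d →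
      ∃ (R : C) (π : TreePath d R), π.EndsInLeaf by
    by_cases hc : ∃ (Q : C) (q : Quantifier) (p : P ⟶ Q) (d : Condition Q), c.Edge q p d
    · obtain ⟨Q, q, p, d, e⟩ := hc
      obtain ⟨R, π, hπ⟩ := h Q q p d e
      exact ⟨R, .cons e π, hπ⟩
    · push Not at hc
      exact ⟨P, .nil c, hc⟩
  induction c with
  | conj c ih =>
    intro Q q p d e
    cases e with
    | conj _ i e => exact ih i Q q p d e
  | disj c ih =>
    intro Q q p d e
    cases e with
    | disj _ i e => exact ih i Q q p d e
  | quant q' p' d' ih =>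
    intro Q q p d e
    cases e
    by_cases hc : ∃ (Q : C) (q : Quantifier) (p : _ ⟶ Q) (d : Condition Q), d'.Edge q p d
    · obtain ⟨Q, q, p, d, e⟩ := hc
      obtain ⟨R, π, hπ⟩ := ih Q q p d e
      exact ⟨R, .cons e π, hπ⟩
    · push Not at hc
      exact ⟨_, .nil d', hc⟩

end Condition

theorem TreePath.comp_mem (hM : IsAdhesiveHLR M) {P R : C} {c : Condition.{w} P}
    (π : TreePath c R) (h : c.AllMem M) : M π.comp := by
  induction π with
  | nil => exact hM.isos (𝟙 _) inferInstance
  | cons e π ih => exact hM.comp _ _ (e.allMem h).1 (ih (e.allMem h).2)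

/-- `Breaks M c q g d`: some path from the root of `c` to a leaf has a node `Pⱼ`, bound by `q`, with
an occurrence `y : Pⱼ ⟶ G` in `M` that extends `d ≫ g` and does not factor through `g : D ⟶ G`,
whereas its restrictions to the nodes above `Pⱼ` do. The leaf occurs in an extension `Y` of `G`. -/
def Breaks (M : MorphismProperty C) {P D G : C} (c : Condition.{w} P) (q : Quantifier)
    (g : D ⟶ G) (d : P ⟶ D) : Prop :=
  ∃ (R : C) (π : TreePath c R) (j : ℕ) (y : π.obj j ⟶ G) (Y : C) (i : G ⟶ Y) (e : R ⟶ Y),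
    π.EndsInLeaf ∧ π.BoundBy q j ∧ M y ∧ π.toObj j ≫ y = d ≫ g ∧ (¬ ∃ z, z ≫ g = y) ∧
    M i ∧ M e ∧ π.fromObj j ≫ e = y ≫ i ∧ π.comp ≫ e = d ≫ g ≫ i ∧
    ∀ m < j, ∃ z : π.obj m ⟶ D, π.fromObj m ≫ e = z ≫ g ≫ i

/-! ### Occurrences not inherited from the context -/

namespace Breaks

/-- Boolean connectives add no nodes: the same path serves, with only its first edge rejustified. -/
theorem of_edges {P D G : C} {c c' : Condition.{w} P} {q : Quantifier} {g : D ⟶ G} {d : P ⟶ D}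
    (hc : ∀ {Q : C} {q : Quantifier} {p : P ⟶ Q} {d : Condition Q}, c.Edge q p d → c'.Edge q p d)
    (h : Breaks M c q g d) : Breaks M c' q g d := by
  obtain ⟨R, π, j, y, Y, i, e, hl, hq, hy, hy', hn, hi, he, hj, h0, hlt⟩ := h
  cases π with
  | nil => exact hq.elim
  | cons a π =>
    cases j with
    | zero => exact hq.elim
    | succ j =>
      refine ⟨R, .cons (hc a) π, j + 1, y, Y, i, e, hl, ?_, hy, hy', hn, hi, he, hj, h0, ?_⟩
      · cases j <;> exact hq
      · intro m hm
        cases m with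
        | zero => exact hlt 0 hm
        | succ m => exact hlt (m + 1) hm

theorem step {P Q D G : C} {p : P ⟶ Q} {c : Condition.{w} Q} {q q' : Quantifier}
    {g : D ⟶ G} {d : Q ⟶ D} {x : P ⟶ D} (hx : p ≫ d = x) (h : Breaks M c q g d) :
    Breaks M (.quant q' p c) q g x := by
  obtain ⟨R, π, j, y, Y, i, e, hl, hq, hy, hy', hn, hi, he, hj, h0, hlt⟩ := h
  subst hx
  have hy'' : (p ≫ π.toObj j) ≫ y = (p ≫ d) ≫ g := by simp [hy']
  -- Level 0 of the longer path uses `p ≫ π.comp`, which is why `Breaks` records the full composite.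
  have h0' : (p ≫ π.comp) ≫ e = (p ≫ d) ≫ g ≫ i := by simp [h0]
  refine ⟨R, .cons (.quant q' p c) π, j + 1, y, Y, i, e, hl, ?_, hy, hy'', hn, hi, he, hj, h0', ?_⟩
  · cases j with
    | zero => cases π <;> exact hq.elim
    | succ j => exact hq
  · intro m hm
    cases m with
    | zero => exact ⟨p ≫ d, h0'⟩
    | succ m => exact hlt m (by omega)

/-- The bad occurrence sits at level 1. The leaf below it need not occur in `G`, so `Y` is the
pushout of `y` and the path down to the leaf; both legs are in `M`. -/
theorem base (hM : IsAdhesiveHLR M) {P Q D G : C} {p : P ⟶ Q} {c : Condition.{w} Q}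
    {q : Quantifier} {g : D ⟶ G} {x : P ⟶ D} (hc : c.AllMem M) {y : Q ⟶ G} (hy : M y)
    (hx : p ≫ y = x ≫ g) (hn : ¬ ∃ z, z ≫ g = y) : Breaks M (.quant q p c) q g x := by
  obtain ⟨R, π, hπ⟩ := c.exists_path_endsInLeaf
  have hm := π.comp_mem hM hc
  have := hM.hasPushout π.comp y hm
  have po := IsPushout.of_hasPushout π.comp y
  have key : ∃ y' : π.obj 0 ⟶ G, M y' ∧ π.toObj 0 ≫ y' = y ∧ (¬ ∃ z, z ≫ g = y') ∧
      π.fromObj 0 ≫ pushout.inl π.comp y = y' ≫ pushout.inr π.comp y := by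
    cases π <;> exact ⟨y, hy, Category.id_comp y, hn, po.w⟩
  obtain ⟨y', hy', ht, hn', hf⟩ := key
  have ht' : (p ≫ π.toObj 0) ≫ y' = x ≫ g := by rw [Category.assoc, ht, hx]
  have h0 : (p ≫ π.comp) ≫ pushout.inl π.comp y = x ≫ g ≫ pushout.inr π.comp y := by
    rw [Category.assoc, po.w, reassoc_of% hx]
  refine ⟨R, .cons (.quant q p c) π, 1, y', _, pushout.inr π.comp y, pushout.inl π.comp y,
    hπ, rfl, hy', ht', hn', hM.pushout_mem po hm, hM.pushout_mem po.flip hy, hf, h0, ?_⟩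
  intro m hm
  obtain rfl : m = 0 := by omega
  exact ⟨x, h0⟩

end Breaks

/-- A condition that is satisfied in `G` but not in `H` either has an existentially bound occurrence
in `G` or a universally bound occurrence in `H` that is not inherited from `D`. -/
theorem Condition.breaks_of_sat_of_not_sat (hM : IsAdhesiveHLR M) {D G H : C} {g : D ⟶ G}
    {h : D ⟶ H} (hg : M g) (hh : M h) {P : C} (c : Condition.{w} P) (hc : c.IsNormal M)
    (x : P ⟶ D) (hs : c.Sat M (x ≫ g)) (hn : ¬ c.Sat M (x ≫ h)) :
    Breaks M c .ex g x ∨ Breaks M c .all h x := by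
  have := hM.mono g hg
  have := hM.mono h hh
  induction c with
  | conj c ih =>
    simp only [Sat, not_forall] at hs hn
    obtain ⟨i, hi⟩ := hn
    exact (ih i (hc i) x (hs i) hi).imp (.of_edges (.conj c i)) (.of_edges (.conj c i))
  | disj c ih =>
    simp only [Sat, not_exists] at hs hn
    obtain ⟨i, hi⟩ := hs
    exact (ih i (hc i) x hi (hn i)).imp (.of_edges (.disj c i)) (.of_edges (.disj c i))
  | quant q p d ih =>
    cases q with
    | ex =>
      obtain ⟨y, hy, hy', hd⟩ := hs
      by_cases hz : ∃ z, z ≫ g = y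
      · obtain ⟨z, rfl⟩ := hz
        -- An inherited witness transports to `H`, where the body must fail; the descent continues
        -- from `z`.
        have hp : p ≫ z = x := by rwa [← cancel_mono g, Category.assoc]
        refine (ih hc.isNormal z hd fun hd' => hn ⟨z ≫ h, ?_, by simp [reassoc_of% hp], hd'⟩).imp
          (.step hp) (.step hp)
        exact hM.comp _ _ (hM.decomp _ _ hy hg) hh
      · exact .inl (.base hM hc hy hy' hz)
    | all =>
      simp only [Sat, not_forall] at hn
      obtain ⟨y, hy, hy', hd⟩ := hn
      by_cases hz : ∃ z, z ≫ h = y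
      · obtain ⟨z, rfl⟩ := hz
        have hp : p ≫ z = x := by rwa [← cancel_mono h, Category.assoc]
        exact (ih hc.isNormal z (hs (z ≫ g) (hM.comp _ _ (hM.decomp _ _ hy hh) hg)
          (by simp [reassoc_of% hp])) hd).imp (.step hp) (.step hp)
      · exact .inr (.base hM hc hy hy' hz)

/-! ### Disabling essences of a pair of transformations -/

namespace LevelEssence

/-- If the proto-essences below level `i` are trivial, then level `i` is reached. -/
theorem of_trivial_below {K L X P₀ Pₙ : C} {c₀ : Condition.{w} P₀} {l : K ⟶ L} {e₁ : L ⟶ X}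
    {π : TreePath c₀ Pₙ} {eₙ : Pₙ ⟶ X} {s i : ℕ} (hsi : s ≤ i)
    (hne : ∀ j, Nonempty (ProtoEssence M l e₁ (π.fromObj j ≫ eₙ)))
    (htriv : ∀ j < i, ∀ e : ProtoEssence M l e₁ (π.fromObj j ≫ eₙ), e.Trivial)
    (e : ProtoEssence M l e₁ (π.fromObj i ≫ eₙ)) : LevelEssence l e₁ π eₙ s i i e := by
  induction i, hsi using Nat.le_induction with
  | base => exact .start e
  | succ i _ ih =>
    obtain ⟨e'⟩ := hne i
    exact .next (ih (fun j hj => htriv j (by omega)) e') (htriv i (by omega) e') e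

/-- The recursion freezes a non-trivial proto-essence, so it survives to the level `π.length` at
which disabling essences are read off. -/
theorem keep_le {K L X P₀ Pₙ : C} {c₀ : Condition.{w} P₀} {l : K ⟶ L} {e₁ : L ⟶ X}
    {π : TreePath c₀ Pₙ} {eₙ : Pₙ ⟶ X} {s i j n : ℕ}
    {e : ProtoEssence M l e₁ (π.fromObj j ≫ eₙ)} (h : LevelEssence l e₁ π eₙ s i j e)
    (he : ¬ e.Trivial) (hn : i ≤ n) : LevelEssence l e₁ π eₙ s n j e := by
  induction n, hn using Nat.le_induction with
  | base => exact h
  | succ n _ ih => exact .keep ih he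

end LevelEssence

namespace Framework

variable {E : CospanClass C} (hC : Framework M E)
include hC

/-- An occurrence that is not inherited gives a non-trivial proto-essence at its level. -/
theorem exists_levelEssence {K L D G P₀ : C} {c : Condition.{w} P₀} {q : Quantifier}
    {l : K ⟶ L} {k : K ⟶ D} {m : L ⟶ G} {g : D ⟶ G} (po : IsPushout l k m g) (hl : M l)
    {d : P₀ ⟶ D} (h : Breaks M c q g d) :
    ∃ (R X : C) (π : TreePath c R) (e₁ : L ⟶ X) (eₙ : R ⟶ X) (j : ℕ) (y : π.obj j ⟶ G)
      (e : ProtoEssence M l e₁ (π.fromObj j ≫ eₙ)),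
      AdmissibleCospan M E e₁ π eₙ ∧ (∀ s ≤ 1, LevelEssence l e₁ π eₙ s π.length j e) ∧
      π.BoundBy q j ∧ ¬ e.Trivial ∧ π.toObj j ≫ y = d ≫ g ∧ IsPullback e.a₁ e.a₂ m y := by
  obtain ⟨R, π, j, y, Y, i, f, hl', hq, hy, hy', hn, hi, hf, hj, -, hlt⟩ := h
  obtain ⟨X, e₁, eₙ, x, he, hx, h₁, rfl⟩ := hC.factorization.exists_factor (m ≫ i) f
  obtain ⟨hj1, hjn⟩ := π.le_length_of_boundBy hq
  have hne : ∀ j, Nonempty (ProtoEssence M l e₁ (π.fromObj j ≫ eₙ)) :=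
    fun j => hC.nonempty_protoEssence hl _ _
  obtain ⟨e⟩ := hne j
  have hnt : ¬ e.Trivial := by
    rwa [hC.trivial_iff_factors po hl e x i hx hi h₁ (by simpa using hj)]
  have := hC.adhesive.mono x hx
  have := hC.adhesive.mono i hi
  refine ⟨R, X, π, e₁, eₙ, j, y, e, ⟨.inl hl', he, fun _ => hC.adhesive.decomp _ _ hf hx⟩,
    -- Both starting levels are needed: 0 for deletion, 1 for insertion.
    fun s hs => .keep_le (.of_trivial_below (hs.trans hj1) hne ?_ e) hnt hjn, hq, hnt, hy',
    isPullback_transfer x i h₁ (by simpa using hj) e.isPullback⟩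
  intro m hm e'
  obtain ⟨z, hz⟩ := hlt m hm
  rw [hC.trivial_iff_factors po hl e' (x := z ≫ g) x i hx hi h₁ (by simpa using hz)]
  exact ⟨z, rfl⟩

variable {ρ₁ ρ₂ : Rule.{w} M} {G : C}

/-- If the match of `t₂` is not inherited by the context of `t₁`, then a disabling essence with legs
ending in the left-hand sides is embeddable. -/
theorem exists_plain_disabling (t₁ : PlainTransformation ρ₁ G) (t₂ : PlainTransformation ρ₂ G)
    (h : ¬ ∃ d : ρ₂.L ⟶ t₁.D, d ≫ t₁.g = t₂.m) :
    ∃ o ∈ disablingEssences E ρ₁ ρ₂, o.IsPlain ∧ o.EmbedsIn t₁ t₂ := by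
  obtain ⟨X, e₁, e₂, x, he, hx, h₁, h₂⟩ := hC.factorization.exists_factor t₁.m t₂.m
  -- The empty path exempts `e₂` from lying in `M`, as matches need not.
  let π : TreePath ρ₂.ac ρ₂.L := .nil _
  obtain ⟨e⟩ := hC.nonempty_protoEssence ρ₁.l_mem e₁ (π.fromObj 0 ≫ e₂)
  have h₂' : (𝟙 ρ₂.L ≫ e₂) ≫ x = t₂.m ≫ 𝟙 G := by simpa using h₂
  have hG : M (𝟙 G) := hC.adhesive.isos _ inferInstance
  have hnt : ¬ e.Trivial := by
    rwa [hC.trivial_iff_factors t₁.left ρ₁.l_mem e x (𝟙 G) hx hG (by simpa using h₁) h₂']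
  have := hC.adhesive.mono x hx
  have hemb : RuleOverlap.EmbedsIn
      ⟨ρ₁.L, π.obj 0, e.A, e.a₁, e.a₂, 𝟙 ρ₁.L, π.toObj 0⟩ t₁ t₂ :=
    ⟨t₁.m, t₂.m, Category.id_comp _, Category.id_comp _, isPullback_transfer x (𝟙 G)
      (by simpa using h₁) h₂' e.isPullback⟩
  exact ⟨_, .inl (.mk e₁ π e₂ 0 e ⟨.inr rfl, he, fun h => (h rfl).elim⟩ (.start e)
    (hC.realizable hemb) (.inl rfl) hnt), ⟨e.A, e.a₁, e.a₂, rfl⟩, hemb⟩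

/-- If the match of `t₂` is inherited by `t₁` but its application condition is not, then a
disabling essence is embeddable. -/
theorem exists_disabling_of_not_sat (t₁ : PlainTransformation ρ₁ G)
    (t₂ : PlainTransformation ρ₂ G) (hs : ρ₂.ac.Sat M t₂.m) (d : ρ₂.L ⟶ t₁.D)
    (hd : d ≫ t₁.g = t₂.m) (hn : ¬ ρ₂.ac.Sat M (d ≫ t₁.h)) :
    ∃ o ∈ disablingEssences E ρ₁ ρ₂, o.EmbedsIn t₁ t₂ := by
  rcases ρ₂.ac.breaks_of_sat_of_not_sat hC.adhesive (t₁.g_mem hC.adhesive) (t₁.h_mem hC.adhesive)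
    ρ₂.ac_normal d (by rwa [hd]) hn with h | h
  · obtain ⟨R, X, π, e₁, eₙ, j, y, e, ha, hlev, hq, hnt, hy, hp⟩ :=
      hC.exists_levelEssence t₁.left ρ₁.l_mem h
    have hemb : RuleOverlap.EmbedsIn
        ⟨ρ₁.L, π.obj j, e.A, e.a₁, e.a₂, 𝟙 ρ₁.L, π.toObj j⟩ t₁ t₂ :=
      ⟨t₁.m, y, Category.id_comp _, hy.trans hd, hp⟩
    exact ⟨_, .inl (.mk e₁ π eₙ j e ha (hlev 0 zero_le_one) (hC.realizable hemb) (.inr hq) hnt),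
      hemb⟩
  · obtain ⟨R, X, π, e₁, eₙ, j, y, e, ha, hlev, hq, hnt, hy, hp⟩ :=
      hC.exists_levelEssence t₁.right ρ₁.r_mem h
    have := hC.hasPullbacks
    -- `Q` is the part of the inserted occurrence already present in `D`; pulling back the right
    -- pushout makes it a pushout complement.
    have hQ := IsPullback.of_hasPullback y t₁.h
    obtain ⟨b, hb, hb'⟩ := hC.adhesive.isPushout_pullback t₁.right ρ₁.r_mem hp e.isPullback' hQ
    have hemb : RuleOverlap.EmbedsIn
        ⟨ρ₁.L, pullback y t₁.h, e.A', e.k' ≫ ρ₁.l, b, 𝟙 ρ₁.L, hQ.lift (π.toObj j) d hy⟩ t₁ t₂ := by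
      refine ⟨t₁.m, pullback.snd y t₁.h ≫ t₁.g, Category.id_comp _, ?_, ?_⟩
      · change hQ.lift (π.toObj j) d hy ≫ pullback.snd y t₁.h ≫ t₁.g = _
        rw [hQ.lift_snd_assoc, hd]
      -- The left square of the transformation is a pullback as well, which moves the overlap from
      -- `D` to `G`.
      · exact hb'.flip.paste_horiz (hC.adhesive.isPullback t₁.left ρ₁.l_mem)
    exact ⟨_, .inr (.mk e₁ π eₙ j e _ b _ _ ha (hlev 1 le_rfl) hb (hQ.lift_fst _ _ hy)
      (hC.realizable hemb) hq hnt), hemb⟩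

end Framework

namespace RuleOverlap

variable {ρ₁ ρ₂ : Rule.{w} M} {G : C}

theorem EmbedsIn.flip {o : RuleOverlap ρ₁.L ρ₂.L} {t₁ : PlainTransformation ρ₁ G}
    {t₂ : PlainTransformation ρ₂ G} (h : o.EmbedsIn t₁ t₂) : o.flip.EmbedsIn t₂ t₁ := by
  obtain ⟨x₁, x₂, h₁, h₂, hp⟩ := h
  exact ⟨x₂, x₁, h₂, h₁, hp.flip⟩

theorem IsPlain.flip {L₁ L₂ : C} {o : RuleOverlap L₁ L₂} (h : o.IsPlain) : o.flip.IsPlain := by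
  obtain ⟨A, b₁, b₂, rfl⟩ := h
  exact ⟨A, b₂, b₁, rfl⟩

end RuleOverlap

end

end ConflictEssence

/-! ### Completeness of conflict essences -/

theorem mainTheorem4 {C : Type u} [Category.{v} C] (M : MorphismProperty C)
    (E : ConflictEssence.CospanClass C) (hC : ConflictEssence.Framework M E)
    (ρ₁ ρ₂ : ConflictEssence.Rule.{w} M) (G : C)
    (t₁ : ConflictEssence.Transformation ρ₁ G) (t₂ : ConflictEssence.Transformation ρ₂ G)
    (hdep : ConflictEssence.ParallelDependent t₁ t₂) :
    ∃ ce ∈ ConflictEssence.conflictEssences E ρ₁ ρ₂,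
      ce.EmbedsIn t₁.toPlainTransformation t₂.toPlainTransformation := by
  by_cases hp : ConflictEssence.PlainIndependent t₁.toPlainTransformation t₂.toPlainTransformation
  · have conflict : ∀ o : ConflictEssence.RuleOverlap ρ₁.L ρ₂.L,
        o.EmbedsIn t₁.toPlainTransformation t₂.toPlainTransformation → o.AcConflicting ρ₁ ρ₂ :=
      fun o ho => ⟨G, _, _, hp, ho⟩
    obtain ⟨d₁, d₂, h₁, h₂⟩ := id hp
    by_cases hs : ρ₂.ac.Sat M (d₁ ≫ t₁.h)
    -- Here `t₂` disables `t₁`, so the essence enters with its sides exchanged.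
    · obtain ⟨o, ho, he⟩ := hC.exists_disabling_of_not_sat t₂.toPlainTransformation
        t₁.toPlainTransformation t₁.sat d₂ h₂ fun hs' => hdep ⟨d₁, d₂, h₁, h₂, hs, hs'⟩
      exact ⟨o.flip, .disabling _ (.inr ho) (.inl (conflict _ he.flip)), he.flip⟩
    · obtain ⟨o, ho, he⟩ := hC.exists_disabling_of_not_sat t₁.toPlainTransformation
        t₂.toPlainTransformation t₂.sat d₁ h₁ hs
      exact ⟨o, .disabling _ (.inl ho) (.inl (conflict _ he)), he⟩
  · by_cases h₁ : ∃ d : ρ₂.L ⟶ t₁.D, d ≫ t₁.g = t₂.m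
    · obtain ⟨o, ho, hpl, he⟩ := hC.exists_plain_disabling t₂.toPlainTransformation
        t₁.toPlainTransformation fun ⟨d₂, h₂⟩ => hp ⟨h₁.choose, d₂, h₁.choose_spec, h₂⟩
      exact ⟨o.flip, .disabling _ (.inr ho) (.inr hpl.flip), he.flip⟩
    · obtain ⟨o, ho, hpl, he⟩ := hC.exists_plain_disabling t₁.toPlainTransformation
        t₂.toPlainTransformation h₁
      exact ⟨o, .disabling _ (.inl ho) (.inr hpl), he⟩
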